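/- **Setting.** Let $S$ be a locally compact Hausdorff space with countable base, $\Omega$ the space of all càdlàg functions $\mathbb R_+\to S$, $X_t(\omega)=\omega(t)$ the coordinate process, $\mathcal F=\sigma(X_t,t\ge 0)$, $\mathcal F_t=\bigcap_{s>t}\sigma(X_r, r\le s)$ and $(\theta_t\omega)(s)=\omega(t+s)$. Let $D\subseteq C(S)$ be a set of continuous real functions, let $\mathcal L$ be a map from $D$ to the Borel functions $S\to\mathbb R$ with $\int_0^t|\mathcal L f(X_s(\omega))|\,ds<\infty$ for all $t\ge0$, $\omega\in\Omega$, $f\in D$, and let $\Sigma\in\mathcal F$. Assume that for every $x\in S$ the probability measure $P_x$ on $(\Omega,\mathcal F)$ solves the martingale problem $(D,\mathcal L,\Sigma,x)$, i.e. $P_x(\Sigma)=1$, $P_x(X_0\in\cdot)=\delta_x$, and for every $f\in D$ the process $f(X_t)-f(X_0)-\int_0^t\mathcal L f(X_s)\,ds$, $t\ge 0$, is a local $P_x$-martingale for $(\mathcal F_t)_{t\ge0}$. The family $(P_x)_{x\in S}$ is called *Feller–Dynkin* if $x\mapsto P_x(A)$ is Borel for all $A\in\mathcal F$; $P_x(\theta_t^{-1}G\mid\mathcal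 F_t)=P_{X_t}(G)$ holds $P_x$-a.s. for all $x\in S$, $t\ge0$, $G\in\mathcal F$; and the operators $T_tf(x)=E_x[f(X_t)]$ satisfy $T_t(C_b(S))\subseteq C_b(S)$ and $T_t(C_0(S))\subseteq C_0(S)$ for all $t\ge0$. **Theorem 2.** Suppose that $S$ is not compact and that there exist compact sets $K,C\subset S$, a constant $\alpha>0$ and a bounded function $U\colon S\to\mathbb R_+$ such that (i) $U\in D$; (ii) $\max_{y\in K}U(y)>0$; (iii) $\inf_{y\in S\setminus C}U(y)>0$; (iv) $\mathcal L U\ge\alpha U$ on $S\setminus K$. Then $(P_x)_{x\in S}$ is not Feller–Dynkin. -/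

import Mathlib

open MeasureTheory ProbabilityTheory Filter Topology Set
open scoped NNReal ENNReal ZeroAtInfty BoundedContinuousFunction

namespace MartingaleProblem

/-- A path `ω : ℝ₊ → S` is càdlàg: right-continuous with left limits in `S`. (At time `0` the
left-neighbourhood filter of `ℝ≥0` is trivial, so no left limit is required there.) -/
def IsCadlag {S : Type*} [TopologicalSpace S] (ω : ℝ≥0 → S) : Prop :=
  ∀ t : ℝ≥0, ContinuousWithinAt ω (Ici t) t ∧ ∃ l : S, Tendsto ω (𝓝[<] t) (𝓝 l)

/-- The space `Ω` of all càdlàg paths `ℝ₊ → S`. -/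
structure CadlagPath (S : Type*) [TopologicalSpace S] where
  /-- the underlying function of time -/
  toFun : ℝ≥0 → S
  isCadlag : IsCadlag toFun

/-- The coordinate process `X_t(ω) = ω(t)`. -/
def coord {S : Type*} [TopologicalSpace S] (t : ℝ≥0) (ω : CadlagPath S) : S := ω.toFun t

/-- The σ-field `σ(X_t, t ≥ 0)` on the path space. -/
instance CadlagPath.instMeasurableSpace {S : Type*} [TopologicalSpace S] [mS : MeasurableSpace S] :
    MeasurableSpace (CadlagPath S) :=
  ⨆ t : ℝ≥0, MeasurableSpace.comap (coord t) mS

/-- The filtration `𝓕ᵒ_t = σ(X_s, s ≤ t)`. -/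
def rawFiltration (S : Type*) [TopologicalSpace S] [mS : MeasurableSpace S] :
    Filtration ℝ≥0 (CadlagPath.instMeasurableSpace (S := S)) where
  seq t := ⨆ s : ℝ≥0, ⨆ _ : s ≤ t, MeasurableSpace.comap (coord s) mS
  mono' _ _ hst := iSup₂_le fun r hr => le_iSup₂_of_le r (hr.trans hst) le_rfl
  le' _ := iSup₂_le fun r _ => le_iSup_of_le r le_rfl

/-- The filtration `𝓕_t = ⋂_{s > t} 𝓕ᵒ_s`. -/
noncomputable def pathFiltration (S : Type*) [TopologicalSpace S] [MeasurableSpace S] :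
    Filtration ℝ≥0 (CadlagPath.instMeasurableSpace (S := S)) :=
  (rawFiltration S).rightCont

theorem pathFiltration_apply (S : Type*) [TopologicalSpace S] [MeasurableSpace S] (t : ℝ≥0) :
    pathFiltration S t = ⨅ s > t, rawFiltration S s :=
  Filtration.rightCont_eq _ t

theorem IsCadlag.shift {S : Type*} [TopologicalSpace S] {ω : ℝ≥0 → S} (h : IsCadlag ω)
    (t : ℝ≥0) : IsCadlag fun s => ω (t + s) := by
  intro s
  have hc : Continuous fun r : ℝ≥0 => t + r := by fun_prop
  refine ⟨?_, ?_⟩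
  · refine ContinuousWithinAt.comp (t := Ici (t + s)) (h (t + s)).1 hc.continuousWithinAt ?_
    intro r hr
    exact add_le_add_right (mem_Ici.1 hr) t
  · obtain ⟨l, hl⟩ := (h (t + s)).2
    refine ⟨l, hl.comp ?_⟩
    refine tendsto_nhdsWithin_of_tendsto_nhds_of_eventually_within _
      (hc.continuousAt.mono_left nhdsWithin_le_nhds) ?_
    filter_upwards [self_mem_nhdsWithin] with r hr
    exact add_lt_add_right (mem_Iio.1 hr) t

/-- The shift operator `(θ_t ω)(s) = ω(t + s)`. -/
def shift {S : Type*} [TopologicalSpace S] (t : ℝ≥0) (ω : CadlagPath S) : CadlagPath S where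
  toFun s := ω.toFun (t + s)
  isCadlag := ω.isCadlag.shift t

/-- Input data `(D, 𝓛, Σ)` of an abstract martingale problem on `S`: a set `D ⊆ C(S)` of test
functions, a map `𝓛 : D → M(S)` into the Borel functions such that `∫₀ᵗ |𝓛 f(X_s(ω))| ds < ∞` for
every `t`, every càdlàg path `ω` and every `f ∈ D`, and a measurable set `Σ` of paths. -/
structure InputData (S : Type*) [TopologicalSpace S] [MeasurableSpace S] where
  /-- the set of test functions -/
  D : Set C(S, ℝ)
  /-- the candidate for an extended generator -/
  L : D → S → ℝ
  measurable_L : ∀ f : D, Measurable (L f)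
  integrable_L : ∀ (f : D) (ω : CadlagPath S) (t : ℝ≥0),
    IntervalIntegrable (fun s : ℝ => L f (coord s.toNNReal ω)) volume 0 t
  /-- the state space for the paths -/
  paths : Set (CadlagPath S)
  measurableSet_paths : MeasurableSet paths

/-- The process `f(X_t) - f(X_0) - ∫₀ᵗ 𝓛 f(X_s) ds`. -/
noncomputable def testProcess {S : Type*} [TopologicalSpace S] [MeasurableSpace S]
    (I : InputData S) (f : I.D) (t : ℝ≥0) (ω : CadlagPath S) : ℝ :=
  (f : C(S, ℝ)) (coord t ω) - (f : C(S, ℝ)) (coord 0 ω)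
    - ∫ s in (0 : ℝ)..t, I.L f (coord s.toNNReal ω)

/-- `M` is a local `P`-martingale for the filtration `(𝓕_t)`. -/
def IsLocalMartingale {S : Type*} [TopologicalSpace S] [MeasurableSpace S]
    (M : ℝ≥0 → CadlagPath S → ℝ) (P : Measure (CadlagPath S)) : Prop :=
  Locally (fun N => Martingale N (pathFiltration S) P) (pathFiltration S) M P

/-- `P` is a solution to the martingale problem `(D, 𝓛, Σ, η)`. -/
structure IsSolution {S : Type*} [TopologicalSpace S] [MeasurableSpace S]
    (I : InputData S) (η : Measure S) (P : Measure (CadlagPath S)) : Prop where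
  isProbabilityMeasure : IsProbabilityMeasure P
  measure_paths : P I.paths = 1
  initial_law : P.map (coord 0) = η
  isLocalMartingale : ∀ f : I.D, IsLocalMartingale (testProcess I f) P

/-- The family `(P_x)` is Markov: `x ↦ P_x(A)` is Borel for every measurable `A`, and
`P_x(θ_t⁻¹ G | 𝓕_t) = P_{X_t}(G)` holds `P_x`-a.s. for all `x`, `t` and measurable `G`. -/
structure IsMarkov {S : Type*} [TopologicalSpace S] [MeasurableSpace S]
    (P : S → Measure (CadlagPath S)) : Prop where
  measurable : ∀ A : Set (CadlagPath S), MeasurableSet A → Measurable fun x => P x A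
  markov : ∀ (x : S) (t : ℝ≥0) (G : Set (CadlagPath S)), MeasurableSet G →
    (P x)[(shift t ⁻¹' G).indicator (fun _ => (1 : ℝ)) | pathFiltration S t]
      =ᵐ[P x] fun ω => (P (coord t ω)).real G

/-- The operators `T_t f(x) = E_x[f(X_t)]`. -/
noncomputable def semigroup {S : Type*} [TopologicalSpace S] [MeasurableSpace S]
    (P : S → Measure (CadlagPath S)) (t : ℝ≥0) (f : S → ℝ) (x : S) : ℝ :=
  ∫ ω, f (coord t ω) ∂(P x)

/-- The family `(P_x)` is `C_b`-Feller: it is Markov and `T_t (C_b(S)) ⊆ C_b(S)` for all `t`. -/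
structure IsCbFeller {S : Type*} [TopologicalSpace S] [MeasurableSpace S]
    (P : S → Measure (CadlagPath S)) : Prop extends IsMarkov P where
  map_Cb : ∀ (t : ℝ≥0) (f : S →ᵇ ℝ), ∃ g : S →ᵇ ℝ, semigroup P t f = g

/-- The family `(P_x)` is Feller-Dynkin: it is `C_b`-Feller and `T_t (C_0(S)) ⊆ C_0(S)` for all
`t`. -/
structure IsFellerDynkin {S : Type*} [TopologicalSpace S] [MeasurableSpace S]
    (P : S → Measure (CadlagPath S)) : Prop extends IsCbFeller P where
  map_C0 : ∀ (t : ℝ≥0) (f : C₀(S, ℝ)), ∃ g : C₀(S, ℝ), semigroup P t f = g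

/-- `U` is a (bounded, non-negative) Lyapunov function for the sets `K`, `C` with constant `α`:
`U ∈ D`, `max_K U > 0`, `inf_{S ∖ C} U > 0` and `𝓛 U ≥ α U` on `S ∖ K`. -/
structure IsLyapunov {S : Type*} [TopologicalSpace S] [MeasurableSpace S]
    (I : InputData S) (K C : Set S) (α : ℝ) (U : S → ℝ) : Prop where
  nonneg : ∀ y, 0 ≤ U y
  bounded : ∃ b : ℝ, ∀ y, U y ≤ b
  max_pos : ∃ m : ℝ, IsGreatest (U '' K) m ∧ 0 < m
  inf_pos : ∃ m : ℝ, IsGLB (U '' Cᶜ) m ∧ 0 < m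
  mem_and_le : ∃ f : I.D, ⇑(f : C(S, ℝ)) = U ∧ ∀ y ∉ K, α * U y ≤ I.L f y

end MartingaleProblem

/-! Starting far out, a Feller–Dynkin process spends almost no time near `K` before a fixed time
`t`, while outside `K` the function `U` grows in mean at rate `α`; a bounded `U` cannot do this for
long. Let `U ≤ b`, `m = inf U > 0` off `C`, and let `h ∈ C₀(S)` be nonnegative with `h = 1` on `K`.
`𝓛 U` is bounded on `K` (`InputData.exists_bound`), so `𝓛 U ≥ α U - β h` everywhere for some `β`.
Fatou's lemma (`add_integral_semigroup_le`) gives `T_s U(x) ≥ U(x) + ∫₀ˢ T_r(α U - β h)(x) dr`. As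
`x` leaves compact sets, `∫₀ᵗ T_r h(x) dr → 0`, since each `T_r h` is in `C₀(S)`. So for a remote
`x`, `T_s U(x) ≥ m/2 + α ∫₀ˢ T_r U(x) dr` for all `s ≤ t`, and `T_t U(x) > b` once `t` is large. -/

namespace MartingaleProblem

/-! ### Joint measurability of paths, and Fubini for occupation integrals -/

section Measurability

variable {S : Type*} [TopologicalSpace S]

theorem measurable_coord [MeasurableSpace S] (t : ℝ≥0) : Measurable (coord (S := S) t) :=
  Measurable.of_comap_le (le_iSup (fun t : ℝ≥0 => MeasurableSpace.comap (coord (S := S) t) _) t)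

/-- Right-continuity: the grid points used lie in `(t, t + 1/(n+1)]`. They take countably many
values, which makes joint measurability in `(t, ω)` pass to the limit. -/
theorem tendsto_coord_natFloor (h : C(S, ℝ)) (t : ℝ≥0) (ω : CadlagPath S) :
    Tendsto (fun n : ℕ => h (coord ((⌊(n + 1) * t⌋₊ + 1 : ℝ≥0) / (n + 1)) ω)) atTop
      (𝓝 (h (coord t ω))) := by
  refine (h.continuous.tendsto _).comp (Tendsto.comp (ω.isCadlag t).1 ?_)
  have hpos : ∀ n : ℕ, (0 : ℝ≥0) < n + 1 := fun n => by positivity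
  have hge : ∀ n : ℕ, t ≤ (⌊(n + 1) * t⌋₊ + 1 : ℝ≥0) / (n + 1) := fun n => by
    rw [le_div_iff₀ (hpos n), mul_comm]
    exact (Nat.lt_floor_add_one _).le
  refine tendsto_nhdsWithin_iff.2 ⟨?_, Eventually.of_forall hge⟩
  refine tendsto_of_tendsto_of_tendsto_of_le_of_le (h := fun n : ℕ => t + 1 / ((n : ℝ≥0) + 1))
    tendsto_const_nhds ?_ hge fun n => ?_
  · simpa using tendsto_const_nhds.add (tendsto_one_div_add_atTop_nhds_zero_nat (𝕜 := ℝ≥0))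
  · simp only
    rw [add_div]
    gcongr
    rw [div_le_iff₀ (hpos n), mul_comm]
    exact Nat.floor_le (by positivity)

variable [MeasurableSpace S]

theorem measurable_uncurry_coord [OpensMeasurableSpace S] (h : C(S, ℝ)) :
    Measurable fun p : ℝ≥0 × CadlagPath S => h (coord p.1 p.2) := by
  refine measurable_of_tendsto_metrizable (fun n => ?_)
    (tendsto_pi_nhds.2 fun p : ℝ≥0 × CadlagPath S => tendsto_coord_natFloor h p.1 p.2)
  have hG : Measurable fun q : CadlagPath S × ℕ =>
      h (coord ((q.2 + 1 : ℝ≥0) / (n + 1)) q.1) := by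
    refine measurable_from_prod_countable_left fun k => ?_
    exact h.continuous.measurable.comp (measurable_coord ((k + 1 : ℝ≥0) / (n + 1)))
  have hF : Measurable fun p : ℝ≥0 × CadlagPath S => ⌊((n : ℝ≥0) + 1) * p.1⌋₊ :=
    Nat.measurable_floor.comp (measurable_fst.const_mul _)
  simpa only [Function.comp_def] using hG.comp (measurable_snd.prodMk hF)

theorem measurable_uncurry_coord_toNNReal [OpensMeasurableSpace S] (h : C(S, ℝ)) :
    Measurable fun p : ℝ × CadlagPath S => h (coord p.1.toNNReal p.2) :=
  (measurable_uncurry_coord h).comp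
    ((measurable_real_toNNReal.comp measurable_fst).prodMk measurable_snd)

variable (h : S →ᵇ ℝ)

theorem norm_semigroup_le (P : S → Measure (CadlagPath S)) (x : S) [IsProbabilityMeasure (P x)]
    (t : ℝ≥0) : ‖semigroup P t h x‖ ≤ ‖h‖ := by
  simpa [semigroup] using norm_integral_le_of_norm_le_const (μ := P x)
    (ae_of_all _ fun ω => h.norm_coe_le_norm (coord t ω))

variable [OpensMeasurableSpace S]

theorem integrable_coord (P : Measure (CadlagPath S)) [IsFiniteMeasure P] (t : ℝ≥0) :
    Integrable (fun ω => h (coord t ω)) P :=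
  Integrable.of_bound (h.continuous.measurable.comp (measurable_coord t)).aestronglyMeasurable ‖h‖
    (ae_of_all _ fun _ => h.norm_coe_le_norm _)

theorem intervalIntegrable_coord (ω : CadlagPath S) (a b : ℝ) :
    IntervalIntegrable (fun s : ℝ => h (coord s.toNNReal ω)) volume a b :=
  (intervalIntegrable_const (c := ‖h‖)).mono_fun
    ((measurable_uncurry_coord_toNNReal h.toContinuousMap).comp
      (measurable_id.prodMk measurable_const)).aestronglyMeasurable
    (ae_of_all _ fun s => by simpa using h.norm_coe_le_norm _)

theorem integrable_uncurry_coord (P : Measure (CadlagPath S)) [IsFiniteMeasure P] (a b : ℝ) :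
    Integrable (fun p : ℝ × CadlagPath S => h (coord p.1.toNNReal p.2))
      ((volume.restrict (uIoc a b)).prod P) :=
  have : IsFiniteMeasure (volume.restrict (uIoc a b)) :=
    inferInstanceAs (IsFiniteMeasure (volume.restrict (Ioc _ _)))
  Integrable.of_bound
    (measurable_uncurry_coord_toNNReal h.toContinuousMap).aestronglyMeasurable ‖h‖
    (ae_of_all _ fun _ => h.norm_coe_le_norm _)

theorem integrable_integral_coord (P : Measure (CadlagPath S)) [IsFiniteMeasure P] (t : ℝ≥0) :
    Integrable (fun ω => ∫ s in (0 : ℝ)..t, h (coord s.toNNReal ω)) P := by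
  have := (integrable_uncurry_coord h P 0 t).integral_prod_right
  have ht : (0 : ℝ) ≤ t := t.2
  simpa only [intervalIntegral.integral_of_le ht, uIoc_of_le ht] using this

theorem integral_integral_coord (P : S → Measure (CadlagPath S)) (x : S) [IsFiniteMeasure (P x)]
    (t : ℝ≥0) :
    ∫ ω, (∫ s in (0 : ℝ)..t, h (coord s.toNNReal ω)) ∂(P x)
      = ∫ s in (0 : ℝ)..t, semigroup P s.toNNReal h x := by
  have := integrable_uncurry_coord h (P x) 0 t
  exact (intervalIntegral_integral_swap (f := fun s ω => h (coord s.toNNReal ω)) this).symm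

theorem measurable_semigroup (P : S → Measure (CadlagPath S)) (x : S) [IsFiniteMeasure (P x)] :
    Measurable fun s : ℝ => semigroup P s.toNNReal h x :=
  ((measurable_uncurry_coord_toNNReal h.toContinuousMap).stronglyMeasurable.integral_prod_right'
    (ν := P x)).measurable

theorem intervalIntegrable_semigroup (P : S → Measure (CadlagPath S)) (x : S)
    [IsProbabilityMeasure (P x)] (a b : ℝ) :
    IntervalIntegrable (fun s : ℝ => semigroup P s.toNNReal h x) volume a b :=
  (intervalIntegrable_const (c := ‖h‖)).mono_fun
    (measurable_semigroup h P x).aestronglyMeasurable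
    (ae_of_all _ fun s => by simpa using norm_semigroup_le h P x _)

end Measurability

/-! ### Boundedness of `𝓛 f` on compact sets -/

section LocalBound

variable {S : Type*} [TopologicalSpace S]

/-- The path is a step function away from `0`, running through `z` backwards; convergence of `z` is
right-continuity at `0`. There `0⁻¹ = 0` makes the value `z 0`, so `z 0` must be the limit. -/
theorem isCadlag_natCeil_inv {z : ℕ → S} (hz : Tendsto z atTop (𝓝 (z 0))) :
    IsCadlag fun t : ℝ≥0 => z ⌈t⁻¹⌉₊ := by
  intro t
  rcases eq_or_ne t 0 with rfl | ht
  · refine ⟨continuousWithinAt_Ioi_iff_Ici.1 ?_, z 0, by simp⟩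
    simp only [ContinuousWithinAt, inv_zero, Nat.ceil_zero]
    refine hz.comp (tendsto_nat_ceil_atTop.comp ?_)
    refine tendsto_atTop.2 fun b => ?_
    have hb : (0 : ℝ≥0) < (b + 1)⁻¹ := by positivity
    filter_upwards [self_mem_nhdsWithin, mem_nhdsWithin_of_mem_nhds (Iio_mem_nhds hb)] with s h0 h1
    have := (lt_inv_comm₀ h0 (by positivity)).1 (mem_Iio.1 h1)
    exact le_self_add.trans this.le
  · have hc : ContinuousAt (fun s : ℝ≥0 => s⁻¹) t := continuousAt_inv₀ ht
    have hpos : 0 < t := pos_iff_ne_zero.2 ht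
    constructor
    · refine tendsto_const_nhds.congr' ?_
      have hlt : ((⌈t⁻¹⌉₊ - 1 : ℕ) : ℝ≥0) < t⁻¹ := by
        have h1 : 0 < ⌈t⁻¹⌉₊ := Nat.ceil_pos.2 (inv_pos.2 hpos)
        exact ((Nat.ceil_eq_iff h1.ne').1 rfl).1
      filter_upwards [self_mem_nhdsWithin,
        mem_nhdsWithin_of_mem_nhds (hc.eventually (lt_mem_nhds hlt))] with s hs h1
      have h2 : s⁻¹ ≤ t⁻¹ := inv_anti₀ hpos hs
      have h3 : ⌈t⁻¹⌉₊ ≠ 0 := (Nat.ceil_pos.2 (inv_pos.2 hpos)).ne'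
      rw [(Nat.ceil_eq_iff h3).2 ⟨h1, h2.trans (Nat.le_ceil _)⟩]
    · refine ⟨z (⌊t⁻¹⌋₊ + 1), tendsto_const_nhds.congr' ?_⟩
      have hlt : t⁻¹ < (⌊t⁻¹⌋₊ + 1 : ℕ) := by exact_mod_cast Nat.lt_floor_add_one _
      filter_upwards [self_mem_nhdsWithin, mem_nhdsWithin_of_mem_nhds (Ioi_mem_nhds hpos),
        mem_nhdsWithin_of_mem_nhds (hc.eventually (gt_mem_nhds hlt))] with s hs h0 h1
      have h2 : t⁻¹ < s⁻¹ := inv_strictAnti₀ h0 hs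
      rw [(Nat.ceil_eq_iff (Nat.succ_ne_zero _)).2 ⟨?_, h1.le⟩]
      simpa using (Nat.floor_le (zero_le)).trans_lt h2

/-- Integrability is required along every càdlàg path. Were `𝓛 f` unbounded on `K`, a path through
points of `K` converging as time decreases to `0` could make `|𝓛 f|` at least `1/s` at time `s`,
which is not integrable at `0`. -/
theorem InputData.exists_bound [FirstCountableTopology S] [MeasurableSpace S] (I : InputData S)
    (f : I.D) {K : Set S} (hK : IsCompact K) : ∃ B : ℝ, ∀ y ∈ K, |I.L f y| ≤ B := by
  by_contra! hcon
  choose y hyK hy using fun n : ℕ => hcon n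
  obtain ⟨a, -, φ, hφ, hlim⟩ := hK.isSeqCompact hyK
  let z : ℕ → S := fun n => if n = 0 then a else y (φ n)
  have hz : Tendsto z atTop (𝓝 (z 0)) := by
    refine hlim.congr' ?_
    filter_upwards [eventually_ne_atTop 0] with n hn
    simp [z, hn]
  have hint := I.integrable_L f ⟨_, isCadlag_natCeil_inv hz⟩ 1
  have hinv : IntervalIntegrable (fun s : ℝ => s⁻¹) volume 0 1 := by
    refine hint.mono_fun measurable_inv.aestronglyMeasurable ?_
    rw [uIoc_of_le (by simp)]
    filter_upwards [ae_restrict_mem measurableSet_Ioc] with s hs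
    have hs0 : 0 < s.toNNReal := Real.toNNReal_pos.2 hs.1
    have hn : ⌈s.toNNReal⁻¹⌉₊ ≠ 0 := (Nat.ceil_pos.2 (inv_pos.2 hs0)).ne'
    have hle : s⁻¹ ≤ (⌈s.toNNReal⁻¹⌉₊ : ℝ) := by
      have := NNReal.coe_le_coe.2 (Nat.le_ceil s.toNNReal⁻¹)
      simpa [Real.coe_toNNReal _ hs.1.le] using this
    simp only [coord, z, if_neg hn, Real.norm_eq_abs]
    rw [abs_of_pos (inv_pos.2 hs.1)]
    calc s⁻¹ ≤ (⌈s.toNNReal⁻¹⌉₊ : ℝ) := hle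
      _ ≤ (φ ⌈s.toNNReal⁻¹⌉₊ : ℝ) := by exact_mod_cast hφ.id_le _
      _ ≤ _ := (hy _).le
  simpa using intervalIntegrable_inv_iff.1 hinv

end LocalBound

/-! ### Fatou's lemma for local martingales bounded above -/

section LowerBound

variable {S : Type*} [TopologicalSpace S] [MeasurableSpace S]

/-- A Fatou argument: a local martingale which is null at time `0` and bounded from above up to
time `t` has non-negative expectation at time `t`, in the sense that it has no majorant of negative
expectation. -/
theorem IsLocalMartingale.integral_nonneg_of_le {M : ℝ≥0 → CadlagPath S → ℝ}
    {P : Measure (CadlagPath S)} [IsProbabilityMeasure P] (hM : IsLocalMartingale M P)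
    (h0 : ∀ ω, M 0 ω = 0) {t : ℝ≥0} {A : ℝ} (hA : 0 ≤ A) (hMA : ∀ s ≤ t, ∀ ω, M s ω ≤ A)
    {Z : CadlagPath S → ℝ} (hZ : Integrable Z P) (hZA : ∀ ω, Z ω ≤ A) (hMZ : ∀ ω, M t ω ≤ Z ω) :
    0 ≤ ∫ ω, Z ω ∂P := by
  obtain ⟨τ, hτ, hmart⟩ := hM
  set Y : ℕ → CadlagPath S → ℝ := fun n =>
    stoppedProcess (fun i ↦ {ω | ⊥ < τ n ω}.indicator (M i)) (τ n) t with hY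
  have hYint : ∀ n, Integrable (Y n) P := fun n => (hmart n).integrable t
  have hYzero : ∀ n, ∫ ω, Y n ω ∂P = 0 := fun n => by
    have h := (hmart n).setIntegral_eq (zero_le (a := t)) MeasurableSet.univ
    simp only [setIntegral_univ] at h
    rw [← h]
    refine integral_eq_zero_of_ae (ae_of_all _ fun ω => ?_)
    have hmin : (min ((0 : ℝ≥0) : WithTop ℝ≥0) (τ n ω)) = (0 : ℝ≥0) := min_eq_left bot_le
    have hbot : ((0 : ℝ≥0) : WithTop ℝ≥0).untopA = 0 := by simp
    simp only [stoppedProcess, hmin, hbot, indicator, h0, ite_self, Pi.zero_apply]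
  have hYA : ∀ n ω, Y n ω ≤ A := fun n ω => by
    simp only [hY, stoppedProcess, indicator]
    -- Where `τ n = 0` the indicator kills the process, hence the need for `0 ≤ A`.
    split_ifs
    · refine hMA _ ?_ ω
      have hne : min (t : WithTop ℝ≥0) (τ n ω) ≠ ⊤ :=
        ((min_le_left _ _).trans_lt (WithTop.coe_lt_top t)).ne
      rw [WithTop.untopA_eq_untop hne, WithTop.untop_le_iff]
      exact min_le_left _ _
    · exact hA
  have hlim : ∀ᵐ ω ∂P, Tendsto (fun n => Y n ω) atTop (𝓝 (M t ω)) := by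
    filter_upwards [hτ.tendsto_top] with ω hω
    refine tendsto_const_nhds.congr' ?_
    filter_upwards [hω.eventually (lt_mem_nhds (WithTop.coe_lt_top t))] with n hn
    simp only [hY]
    rw [stoppedProcess_eq_of_le hn.le, indicator_of_mem]
    exact lt_of_le_of_lt bot_le hn
  -- Each `A - Y n` is nonnegative with mean `A`. Lower integrals avoid asking whether `M t` is
  -- integrable.
  have hfatou : ∫⁻ ω, ENNReal.ofReal (A - M t ω) ∂P ≤ ENNReal.ofReal A := by
    calc ∫⁻ ω, ENNReal.ofReal (A - M t ω) ∂P
        = ∫⁻ ω, liminf (fun n => ENNReal.ofReal (A - Y n ω)) atTop ∂P := by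
          refine lintegral_congr_ae ?_
          filter_upwards [hlim] with ω hω
          exact ((ENNReal.tendsto_ofReal (tendsto_const_nhds.sub hω)).liminf_eq).symm
      _ ≤ liminf (fun n => ∫⁻ ω, ENNReal.ofReal (A - Y n ω) ∂P) atTop :=
          lintegral_liminf_le' fun n =>
            ((hYint n).aestronglyMeasurable.aemeasurable.const_sub A).ennreal_ofReal
      _ = ENNReal.ofReal A := by
          refine (tendsto_const_nhds.congr fun n => ?_).liminf_eq
          have h := ofReal_integral_eq_lintegral_ofReal ((integrable_const A).sub (hYint n))
            (ae_of_all _ fun ω => sub_nonneg.2 (hYA n ω))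
          rw [integral_sub' (integrable_const A) (hYint n), hYzero] at h
          simpa using h
  have hle : ENNReal.ofReal (∫ ω, (A - Z ω) ∂P) ≤ ENNReal.ofReal A := by
    refine (ofReal_integral_eq_lintegral_ofReal ((integrable_const A).sub hZ)
      (ae_of_all _ fun ω => sub_nonneg.2 (hZA ω))).trans_le ?_
    exact (lintegral_mono fun ω => ENNReal.ofReal_le_ofReal (sub_le_sub_left (hMZ ω) A)).trans hfatou
  rw [ENNReal.ofReal_le_ofReal_iff hA, integral_sub (integrable_const A) hZ] at hle
  simpa using hle

variable [OpensMeasurableSpace S]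

/-- If `𝓛 f` has the bounded continuous lower bound `k`, then
`f(x) + ∫₀ᵗ T_s k(x) ds ≤ T_t f(x)`. -/
theorem add_integral_semigroup_le {I : InputData S} {P : S → Measure (CadlagPath S)} {x : S}
    [MeasurableSingletonClass S]
    (hP : IsSolution I (Measure.dirac x) (P x)) (f : I.D) {F k : S →ᵇ ℝ}
    (hF : ∀ y, (f : C(S, ℝ)) y = F y) (hk : ∀ y, k y ≤ I.L f y) (t : ℝ≥0) :
    F x + ∫ s in (0 : ℝ)..t, semigroup P s.toNNReal k x ≤ semigroup P t F x := by
  have := hP.isProbabilityMeasure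
  have hFb : ∀ y, |F y| ≤ ‖F‖ := F.norm_coe_le_norm
  have hkb : ∀ (s : ℝ≥0) ω, |∫ r in (0 : ℝ)..s, k (coord r.toNNReal ω)| ≤ ‖k‖ * s := fun s ω => by
    simpa using intervalIntegral.norm_integral_le_of_norm_le_const (a := 0) (b := (s : ℝ))
      fun r _ => k.norm_coe_le_norm (coord r.toNNReal ω)
  set Z : ℝ≥0 → CadlagPath S → ℝ := fun s ω =>
    F (coord s ω) - F (coord 0 ω) - ∫ r in (0 : ℝ)..s, k (coord r.toNNReal ω)
  have hMZ : ∀ s ω, testProcess I f s ω ≤ Z s ω := fun s ω => by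
    simp only [testProcess, hF, Z]
    gcongr
    exact intervalIntegral.integral_mono_on s.2 (intervalIntegrable_coord k ω _ _)
      (I.integrable_L f ω s) fun r _ => hk _
  have hZA : ∀ s ≤ t, ∀ ω, Z s ω ≤ 2 * ‖F‖ + ‖k‖ * t := fun s hs ω => by
    have h1 := abs_le.1 (hFb (coord s ω))
    have h2 := abs_le.1 (hFb (coord 0 ω))
    have h3 := abs_le.1 (hkb s ω)
    have h4 : ‖k‖ * (s : ℝ) ≤ ‖k‖ * t := by gcongr
    simp only [Z]
    linarith
  have hZint : Integrable (Z t) (P x) :=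
    ((integrable_coord F _ t).sub (integrable_coord F _ 0)).sub (integrable_integral_coord k _ t)
  have h0 : ∫ ω, F (coord 0 ω) ∂(P x) = F x := by
    rw [← integral_map (f := F) (measurable_coord 0).aemeasurable
      F.continuous.measurable.aestronglyMeasurable, hP.initial_law, integral_dirac]
  have hnn := (hP.isLocalMartingale f).integral_nonneg_of_le (fun ω => by simp [testProcess])
    (by positivity) (fun s hs ω => (hMZ s ω).trans (hZA s hs ω)) hZint (hZA t le_rfl) (hMZ t)
  have heq : ∫ ω, Z t ω ∂(P x) = semigroup P t F x - F x
      - ∫ s in (0 : ℝ)..t, semigroup P s.toNNReal k x := by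
    rw [← integral_integral_coord, semigroup, ← h0, ← integral_sub (integrable_coord F _ t)
      (integrable_coord F _ 0)]
    exact integral_sub ((integrable_coord F _ t).sub (integrable_coord F _ 0))
      (integrable_integral_coord k _ t)
  linarith

end LowerBound

/-! ### Behaviour at infinity and the contradiction -/

theorem exists_seq_tendsto_cocompact {S : Type*} [TopologicalSpace S] [WeaklyLocallyCompactSpace S]
    [SigmaCompactSpace S] (hS : ¬ CompactSpace S) :
    ∃ x : ℕ → S, Tendsto x atTop (cocompact S) := by
  let E : CompactExhaustion S := default
  have hne : ∀ n, ∃ x, x ∉ E n := fun n => by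
    by_contra! h
    exact hS ⟨by simpa [eq_univ_of_forall h] using E.isCompact n⟩
  choose x hx using hne
  refine ⟨x, (hasBasis_cocompact.tendsto_right_iff).2 fun K hK => ?_⟩
  obtain ⟨N, hN⟩ := E.exists_superset_of_isCompact hK
  filter_upwards [eventually_ge_atTop N] with n hn hxK
  exact hx n (E.subset hn (hN hxK))

/-- For a Feller-Dynkin family, the occupation integrals of a `C₀`-function vanish at infinity. -/
theorem IsFellerDynkin.tendsto_integral_semigroup {S : Type*} [TopologicalSpace S]
    [MeasurableSpace S] [OpensMeasurableSpace S] {P : S → Measure (CadlagPath S)}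
    [∀ x, IsProbabilityMeasure (P x)] (hP : IsFellerDynkin P) (h : C₀(S, ℝ)) {x : ℕ → S}
    (hx : Tendsto x atTop (cocompact S)) (t : ℝ) :
    Tendsto (fun n => ∫ s in (0 : ℝ)..t, semigroup P s.toNNReal h (x n)) atTop (𝓝 0) := by
  have hlim := intervalIntegral.tendsto_integral_filter_of_dominated_convergence (μ := volume) (a := 0) (b := t)
    (F := fun n s => semigroup P s.toNNReal h (x n)) (f := fun _ => 0) (fun _ => ‖h.toBCF‖)
    (Eventually.of_forall fun n =>
      (measurable_semigroup h.toBCF P (x n)).aestronglyMeasurable)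
    (Eventually.of_forall fun n => ae_of_all _ fun s _ => norm_semigroup_le h.toBCF P (x n) _)
    intervalIntegrable_const (ae_of_all _ fun s _ => by
      obtain ⟨g, hg⟩ := hP.map_C0 s.toNNReal h
      rw [hg]
      exact g.zero_at_infty'.comp hx)
  simpa using hlim

end MartingaleProblem

theorem theorem2 {S : Type*} [TopologicalSpace S] [LocallyCompactSpace S] [T2Space S]
    [SecondCountableTopology S] [MeasurableSpace S] [BorelSpace S]
    (I : MartingaleProblem.InputData S)
    (P : S → Measure (MartingaleProblem.CadlagPath S))
    (hP : ∀ x, MartingaleProblem.IsSolution I (Measure.dirac x) (P x))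
    (hS : ¬ CompactSpace S)
    (hU : ∃ K C : Set S, IsCompact K ∧ IsCompact C ∧ ∃ α : ℝ, 0 < α ∧
      ∃ U : S → ℝ, MartingaleProblem.IsLyapunov I K C α U) :
    ¬ MartingaleProblem.IsFellerDynkin P := by
  open MartingaleProblem in
  intro hFD
  obtain ⟨K, C, hK, hC, α, hα, U, hU⟩ := hU
  have := fun x => (hP x).isProbabilityMeasure
  obtain ⟨f, rfl, hLf⟩ := hU.mem_and_le
  obtain ⟨b, hb⟩ := hU.bounded
  obtain ⟨m, hm, hm0⟩ := hU.inf_pos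
  obtain ⟨B, hB⟩ := I.exists_bound f hK
  obtain ⟨x₀⟩ : Nonempty S := by
    by_contra h
    rw [not_nonempty_iff] at h
    exact hS inferInstance
  have hb0 : 0 ≤ b := (hU.nonneg x₀).trans (hb x₀)
  let F : S →ᵇ ℝ := BoundedContinuousFunction.ofNormedAddCommGroup _
    (f : C(S, ℝ)).continuous b fun y => by
      rw [Real.norm_eq_abs, abs_of_nonneg (hU.nonneg y)]; exact hb y
  obtain ⟨h₁, hh₁, -, hh₂, hh₃⟩ :=
    exists_continuous_one_zero_of_isCompact hK isClosed_empty (disjoint_empty K)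
  let h : C₀(S, ℝ) := ⟨h₁, hh₂.is_zero_at_infty⟩
  -- On `K`, where `h = 1`, this gives `α U - β ≤ -|B| ≤ 𝓛 U`; off `K` the term `-β h` only helps.
  set β : ℝ := |B| + α * b with hβ
  have hβ0 : 0 ≤ β := by positivity
  let k : S →ᵇ ℝ := α • F - β • h.toBCF
  have hk : ∀ y, k y ≤ I.L f y := fun y => by
    change α * (f : C(S, ℝ)) y - β * h₁ y ≤ _
    by_cases hy : y ∈ K
    · have h1 := (abs_le.1 (hB y hy)).1
      have h2 : h₁ y = 1 := hh₁ hy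
      have h3 := mul_le_mul_of_nonneg_left (hb y) hα.le
      rw [h2]
      linarith [le_abs_self B]
    · linarith [hLf y hy, mul_nonneg hβ0 (hh₃ y).1]
  obtain ⟨x, hx⟩ := exists_seq_tendsto_cocompact hS
  obtain ⟨t, ht⟩ : ∃ t : ℝ≥0, b < m / 2 + α * (m / 2) * t := by
    refine ⟨⟨b / (α * (m / 2)), by positivity⟩, ?_⟩
    change b < m / 2 + α * (m / 2) * (b / (α * (m / 2)))
    rw [mul_div_cancel₀ _ (by positivity)]
    linarith
  -- Half of the initial value `U(x n) ≥ m` is reserved to absorb the error from `h`.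
  have hsmall := (((hFD.tendsto_integral_semigroup h hx t).const_mul β).eventually
    (gt_mem_nhds (show β * 0 < m / 2 by simpa using by positivity))).and
    (hx.eventually hC.compl_mem_cocompact)
  obtain ⟨n, hn, hxC⟩ := hsmall.exists
  have hFx : m ≤ F (x n) := hm.1 ⟨x n, hxC, rfl⟩
  have hh0 : ∀ s, 0 ≤ semigroup P s h (x n) := fun s => integral_nonneg fun ω => (hh₃ _).1
  have hF0 : ∀ s, 0 ≤ semigroup P s F (x n) := fun s => integral_nonneg fun ω => hU.nonneg _
  have hmain : ∀ s ≤ t, m / 2 + α * ∫ r in (0 : ℝ)..s, semigroup P r.toNNReal F (x n)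
      ≤ semigroup P s F (x n) := fun s hs => by
    have h1 := add_integral_semigroup_le (hP (x n)) f (F := F) (fun _ => rfl) hk s
    have h2 : ∀ r, semigroup P r k (x n)
        = α * semigroup P r F (x n) - β * semigroup P r h (x n) := fun r => by
      simp only [semigroup]
      rw [← integral_const_mul, ← integral_const_mul]
      exact integral_sub ((integrable_coord F _ r).const_mul α)
        ((integrable_coord h.toBCF _ r).const_mul β)
    simp only [h2] at h1
    have hiF := intervalIntegrable_semigroup F P (x n) 0 s
    have hih : IntervalIntegrable (fun r : ℝ => semigroup P r.toNNReal h (x n)) volume 0 s :=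
      intervalIntegrable_semigroup h.toBCF P (x n) 0 s
    rw [intervalIntegral.integral_sub (hiF.const_mul α) (hih.const_mul β),
      intervalIntegral.integral_const_mul, intervalIntegral.integral_const_mul] at h1
    have h3 : ∫ r in (0 : ℝ)..s, semigroup P r.toNNReal h (x n)
        ≤ ∫ r in (0 : ℝ)..t, semigroup P r.toNNReal h (x n) :=
      intervalIntegral.integral_mono_interval le_rfl s.2 hs (ae_of_all _ fun r => hh0 _)
        (intervalIntegrable_semigroup h.toBCF P (x n) 0 t)
    have h4 := mul_le_mul_of_nonneg_left h3 hβ0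
    linarith
  -- One iteration replaces Grönwall: the constant bound `m/2`, fed back into `hmain`, gives linear
  -- growth in `t`, enough to pass `b`.
  have hlow : ∀ s ≤ t, m / 2 ≤ semigroup P s F (x n) := fun s hs => by
    have h1 := hmain s hs
    have h2 := intervalIntegral.integral_nonneg (μ := volume) (show (0 : ℝ) ≤ s from s.2)
      fun r _ => hF0 r.toNNReal
    linarith [mul_nonneg hα.le h2]
  have hint : m / 2 * t ≤ ∫ r in (0 : ℝ)..t, semigroup P r.toNNReal F (x n) := by
    have h1 := intervalIntegral.integral_mono_on (show (0 : ℝ) ≤ t from t.2)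
      (intervalIntegrable_const (c := m / 2)) (intervalIntegrable_semigroup F P (x n) 0 t)
      fun r hr => hlow _ (Real.toNNReal_le_iff_le_coe.2 hr.2)
    rw [intervalIntegral.integral_const, smul_eq_mul, sub_zero] at h1
    rwa [mul_comm]
  have hup : semigroup P t F (x n) ≤ b := by
    have h1 := integral_mono (integrable_coord F (P (x n)) t) (integrable_const b)
      fun ω => hb (coord t ω)
    simpa [semigroup] using h1
  have h1 := hmain t le_rfl
  have h2 := mul_le_mul_of_nonneg_left hint hα.le
  linarith
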